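/- Let $0<a<\tfrac16$ and let $F:\mathbb R^2\to\mathbb R^2$ be the map $$F(x,y)=(x+2a\sin x+a\sin y,\; y+a\sin x+2a\sin y).$$ For a fixed point $p$ of $F$ let $W^u(p)$ be the set of points $z$ having a backward orbit $z=X_0,X_1,X_2,\dots$, $F(X_{n+1})=X_n$, with $X_n\to p$, and let $W^s(p)=\{z: F^n(z)\to p\}$. Let $$s_2=\{(x,y): x-\pi\le y\le x,\ -x+\pi\le y\le -x+2\pi\}.$$ Then $(\pi,0)$ is a saddle of $F$ (a fixed point at which $DF$ has one eigenvalue of modulus less than $1$ and one of modulus greater than $1$), $(\pi,\pi)$ is a sink (a fixed point at which all eigenvalues of $DF$ have modulus less than $1$), and $F(s_2)\subseteq s_2$. There is a heteroclinic curve $C$ from $(\pi,0)$ to $(\pi,\pi)$, that is, a set $C\subseteq W^u(\pi,0)\cap W^s(\pi,\pi)$ with $F(C)=C$ which is the image of an injective $C^\infty$ immersion $\gamma:\mathbb R\to\mathbb R^2$ with $\gamma(t)\to(\pi,0)$ as $t\to-\infty$ and $\gamma(t)\to(\pi,\pi)$ as $t\to+\infty$. Moreover $C$ is the unstable branch of the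 saddle that lies in $s_2$: the set $W^u(\pi,0)$ is the image of an injective $C^\infty$ immersion $\sigma:\mathbb R\to\mathbb R^2$ with $\sigma(0)=(\pi,0)$ and $\sigma'(0)=(2-\sqrt3,1)$ (the unstable eigenvector), $C=\sigma((0,\infty))$, and $C=(W^u(\pi,0)\cap s_2)\setminus\{(\pi,0)\}$. -/

import Mathlib

open Filter Topology
open scoped ContDiff

namespace AlignedClocks

/-- The map of the phase differences of three aligned clocks with nearest-neighbour coupling `a`. -/
noncomputable def clockMap (a : ℝ) (z : ℝ × ℝ) : ℝ × ℝ :=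
  (z.1 + 2 * a * Real.sin z.1 + a * Real.sin z.2,
   z.2 + a * Real.sin z.1 + 2 * a * Real.sin z.2)

/-- The small square with bottom vertex `(π, 0)` and top vertex `(π, π)`. -/
def smallSquare : Set (ℝ × ℝ) :=
  {z | z.1 - Real.pi ≤ z.2 ∧ z.2 ≤ z.1 ∧ -z.1 + Real.pi ≤ z.2 ∧ z.2 ≤ -z.1 + 2 * Real.pi}

/-- The complex eigenvalues of the derivative of `F` at `p`. -/
noncomputable def multipliers (F : ℝ × ℝ → ℝ × ℝ) (p : ℝ × ℝ) : Multiset ℂ :=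
  (LinearMap.charpoly (fderiv ℝ F p : (ℝ × ℝ) →ₗ[ℝ] (ℝ × ℝ))).aroots ℂ

/-- `p` is a hyperbolic fixed point of `F` with one contracting and one expanding eigenvalue. -/
def IsSaddle (F : ℝ × ℝ → ℝ × ℝ) (p : ℝ × ℝ) : Prop :=
  F p = p ∧ DifferentiableAt ℝ F p ∧
    (∃ μ ∈ multipliers F p, ‖μ‖ < 1) ∧ (∃ μ ∈ multipliers F p, 1 < ‖μ‖)

/-- `p` is a fixed point of `F` at which all eigenvalues are contracting. -/
def IsSink (F : ℝ × ℝ → ℝ × ℝ) (p : ℝ × ℝ) : Prop :=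
  F p = p ∧ DifferentiableAt ℝ F p ∧ ∀ μ ∈ multipliers F p, ‖μ‖ < 1

/-- The global stable set of `p`: the points whose forward orbit converges to `p`. -/
def stableSet (F : ℝ × ℝ → ℝ × ℝ) (p : ℝ × ℝ) : Set (ℝ × ℝ) :=
  {z | Tendsto (fun n : ℕ => F^[n] z) atTop (𝓝 p)}

/-- The global unstable set of `p`: the points with a backward orbit that converges to `p`
(for invertible `F` the backward orbit is unique). -/
def unstableSet (F : ℝ × ℝ → ℝ × ℝ) (p : ℝ × ℝ) : Set (ℝ × ℝ) :=
  {z | ∃ X : ℕ → ℝ × ℝ, X 0 = z ∧ (∀ n, F (X (n + 1)) = X n) ∧ Tendsto X atTop (𝓝 p)}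

/-- `γ` is an injective smooth immersion of the real line. -/
def IsSmoothSimpleCurve (γ : ℝ → ℝ × ℝ) : Prop :=
  ContDiff ℝ ∞ γ ∧ Function.Injective γ ∧ ∀ t, deriv γ t ≠ 0

/-- `C` is a heteroclinic curve of `F` from `p` to `q`: a smooth simple curve with `F(C) = C` that
runs from `p` to `q`, and whose points all have backward orbits converging to `p` and forward
orbits converging to `q`. -/
def IsHeteroclinicCurve (F : ℝ × ℝ → ℝ × ℝ) (p q : ℝ × ℝ) (C : Set (ℝ × ℝ)) : Prop :=
  F '' C = C ∧ C ⊆ unstableSet F p ∩ stableSet F q ∧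
    ∃ γ : ℝ → ℝ × ℝ, IsSmoothSimpleCurve γ ∧ Set.range γ = C ∧
      Tendsto γ atBot (𝓝 p) ∧ Tendsto γ atTop (𝓝 q)

/-- `C` is the branch, in the direction `v`, of the one-dimensional unstable manifold of `p`:
the unstable set of `p` is a smooth simple curve through `p` with velocity `v` there, and `C` is
the part of it on the positive side of `p`. -/
def IsUnstableBranch (F : ℝ × ℝ → ℝ × ℝ) (p v : ℝ × ℝ) (C : Set (ℝ × ℝ)) : Prop :=
  ∃ γ : ℝ → ℝ × ℝ, IsSmoothSimpleCurve γ ∧ γ 0 = p ∧ deriv γ 0 = v ∧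
    Set.range γ = unstableSet F p ∧ γ '' Set.Ioi 0 = C

end AlignedClocks

/-
Let `v` be the unstable eigenvector of the saddle `p = (π, 0)` and `l = 1 + √3 a` its eigenvalue.
On the complexification, `F^n (p + (t / l^n) v)` converges to an entire curve `σ` with
`F (σ t) = σ (l t)`: near `p` the map is Lipschitz with a constant less than `l^2`, which beats the
quadratic error of the tangent line. So `σ` is smooth, and since `F` has a Lipschitz inverse, `σ`
inherits injectivity and `σ' ≠ 0` from their validity near `0`. The range of `σ` is all of `W^u(p)`:
the difference of two backward orbits with the same unstable coordinate lies in the stable cone,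
where going backwards cannot shrink it, yet it tends to `0`.

In coordinates along its sides the square `s₂` becomes `[0, π/2]²`, where `F` increases both
coordinates and contracts towards the corner `(π, π)` uniformly away from the sides through `p`.
The curve enters the square for `t > 0`, hence converges to the sink, and `F` commutes with the
reflection in `p`, which puts the other half of the curve outside the square.
-/

namespace AlignedClocks

open scoped NNReal

lemma tendsto_div_pow_nhds_zero {𝕜 : Type*} [NormedField 𝕜] {l : 𝕜} (hl : 1 < ‖l‖) (t : 𝕜) :
    Tendsto (fun n : ℕ => t / l ^ n) atTop (𝓝 0) := by
  have h : Tendsto (fun n : ℕ => l⁻¹ ^ n) atTop (𝓝 0) :=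
    tendsto_pow_atTop_nhds_zero_of_norm_lt_one (by rw [norm_inv]; exact inv_lt_one_of_one_lt₀ hl)
  simpa [div_eq_mul_inv] using h.const_mul t

lemma tendstoUniformlyOn_iterate_of_dist_le {α : Type*} [PseudoMetricSpace α] {f : α → α}
    {S : Set α} {q : α} {c B : ℝ} (hf : Set.MapsTo f S S) (hc0 : 0 ≤ c) (hc : c < 1)
    (h : ∀ z ∈ S, dist (f z) q ≤ c * dist z q) (hB : ∀ z ∈ S, dist z q ≤ B) :
    TendstoUniformlyOn (fun n => f^[n]) (fun _ => q) atTop S := by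
  have hiter (n : ℕ) : ∀ z ∈ S, dist (f^[n] z) q ≤ c ^ n * B := by
    induction n with
    | zero => simpa using hB
    | succ n ih =>
      intro z hz
      rw [Function.iterate_succ_apply', pow_succ', mul_assoc]
      exact (h _ (hf.iterate n hz)).trans (mul_le_mul_of_nonneg_left (ih z hz) hc0)
  have hlim : Tendsto (fun n => c ^ n * B) atTop (𝓝 0) := by
    simpa using (tendsto_pow_atTop_nhds_zero_of_lt_one hc0 hc).mul_const B
  refine Metric.tendstoUniformlyOn_iff.2 fun ε hε => ?_
  filter_upwards [hlim.eventually_lt_const hε] with n hn z hz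
  rw [dist_comm]
  exact (hiter n z hz).trans_lt hn

section LinearizingParametrization

/-- The `n`-th approximation `t ↦ F^n (p + (t / l ^ n) v)` of Poincaré's parametrization of the
unstable manifold of `F` at `p`, in the direction of an eigenvector `v` with eigenvalue `l`. -/
def unstableApprox {𝕜 V : Type*} [Field 𝕜] [AddCommGroup V] [Module 𝕜 V]
    (F : V → V) (p v : V) (l : 𝕜) (n : ℕ) (t : 𝕜) : V :=
  F^[n] (p + (t / l ^ n) • v)

section Algebra

variable {𝕜 V : Type*} [Field 𝕜] [AddCommGroup V] [Module 𝕜 V] (F : V → V) (p v : V) (l : 𝕜)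

lemma unstableApprox_zero (t : 𝕜) : unstableApprox F p v l 0 t = p + t • v := by
  simp [unstableApprox]

lemma unstableApprox_add (n k : ℕ) (t : 𝕜) :
    unstableApprox F p v l (n + k) t = F^[k] (unstableApprox F p v l n (t / l ^ k)) := by
  rw [unstableApprox, unstableApprox, add_comm n k, Function.iterate_add_apply, pow_add, div_div]

lemma unstableApprox_succ (n : ℕ) (t : 𝕜) :
    unstableApprox F p v l (n + 1) t = F (unstableApprox F p v l n (t / l)) := by
  rw [unstableApprox_add, pow_one, Function.iterate_one]

end Algebra

section Complex

variable {E : Type*} [NormedAddCommGroup E] [NormedSpace ℂ E] {G : E → E} {p v : E} {l : ℂ}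

lemma differentiable_unstableApprox (hG : Differentiable ℂ G) (n : ℕ) :
    Differentiable ℂ (unstableApprox G p v l n) :=
  (hG.iterate n).comp (((differentiable_id.div_const _).smul_const v).const_add p)

/-- A neighbourhood `U` of the parabolic tube of radii `C ‖t‖ ^ 2` around the tangent disc
`t ↦ p + t v`, `‖t‖ < δ`, on which `G` is `μ`-Lipschitz, with `C` so large that `G` maps the tube
into itself up to the factor `l` in `t`. All approximations `unstableApprox` stay in the tube. -/
structure IsTangentTube (G : E → E) (p v : E) (l : ℂ) (U : Set E) (μ : ℝ≥0) (C δ : ℝ) :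
    Prop where
  nonneg : 0 ≤ C
  closedBall_subset : ∀ t : ℂ, ‖t‖ < δ → Metric.closedBall (p + t • v) (C * ‖t‖ ^ 2) ⊆ U
  lipschitzOnWith : LipschitzOnWith μ G U
  norm_sub_le : ∀ t : ℂ, ‖t‖ < δ →
    ‖G (p + t • v) - (p + (l * t) • v)‖ ≤ (‖l‖ ^ 2 - μ) * C * ‖t‖ ^ 2

lemma isBigO_taylor_one [CompleteSpace E] {g : ℂ → E} (hg : Differentiable ℂ g) (c : ℂ) :
    (fun t => g t - g c - (t - c) • deriv g c) =O[𝓝 c] fun t => ‖t - c‖ ^ 2 := by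
  have hd : DifferentiableAt ℂ (dslope g c) c :=
    ((Complex.differentiableOn_dslope univ_mem).2 hg.differentiableOn).differentiableAt univ_mem
  have h := (Asymptotics.isBigO_refl (fun t : ℂ => t - c) (𝓝 c)).smul hd.isBigO_sub
  refine (h.congr_left fun t => ?_).trans (Asymptotics.IsBigO.of_norm_le fun t => ?_)
  · rw [smul_sub, sub_smul_dslope, dslope_same]
  · rw [smul_eq_mul, norm_mul, ← sq]

lemma exists_isTangentTube [CompleteSpace E] {A : E →L[ℂ] E} (hG : Differentiable ℂ G)
    (hA : HasStrictFDerivAt G A p) (hp : G p = p) (hv : A v = l • v) (hAl : ‖A‖ < ‖l‖ ^ 2) :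
    ∃ U μ C δ, IsTangentTube G p v l U μ C δ ∧ (μ : ℝ) < ‖l‖ ^ 2 ∧ 0 < δ := by
  obtain ⟨μ, hAμ, hμl⟩ := exists_between (show ‖A‖₊ < ‖l‖₊ ^ 2 from hAl)
  have hμl' : 0 < ‖l‖ ^ 2 - μ := sub_pos.2 (by exact_mod_cast hμl)
  obtain ⟨U, hU, hGU⟩ := hA.exists_lipschitzOnWith_of_nnnorm_lt μ hAμ
  have hline : Differentiable ℂ fun t : ℂ => G (p + t • v) :=
    hG.comp ((differentiable_id.smul_const v).const_add p)
  have hderiv : HasDerivAt (fun t : ℂ => G (p + t • v)) (l • v) 0 := by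
    have h : HasDerivAt (fun t : ℂ => p + t • v) v 0 := by
      simpa using ((hasDerivAt_id (0 : ℂ)).smul_const v).const_add p
    rw [← hv]
    exact HasFDerivAt.comp_hasDerivAt_of_eq 0 hA.hasFDerivAt h (by simp)
  obtain ⟨K, hK0, hK⟩ := (isBigO_taylor_one hline 0).exists_nonneg
  have htube : ∀ᶠ t : ℂ in 𝓝 0,
      Metric.closedBall (p + t • v) (K / (‖l‖ ^ 2 - μ) * ‖t‖ ^ 2) ⊆ U := by
    obtain ⟨r, hr, hrU⟩ := Metric.mem_nhds_iff.1 hU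
    have hc : Continuous fun t : ℂ => K / (‖l‖ ^ 2 - μ) * ‖t‖ ^ 2 + ‖t • v‖ := by fun_prop
    filter_upwards [hc.continuousAt.eventually_lt_const (by simpa using hr)] with t ht
    exact (Metric.closedBall_subset_ball' (by simpa using ht)).trans hrU
  obtain ⟨δ, hδ, h⟩ := Metric.eventually_nhds_iff.1 (htube.and hK.bound)
  refine ⟨U, μ, K / (‖l‖ ^ 2 - μ), δ,
    ⟨div_nonneg hK0 hμl'.le, fun t ht => (h (by simpa using ht)).1, hGU, fun t ht => ?_⟩,
    by exact_mod_cast hμl, hδ⟩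
  have ht := (h (y := t) (by simpa using ht)).2
  rw [hderiv.deriv] at ht
  rw [mul_div_cancel₀ _ hμl'.ne']
  simpa [hp, smul_smul, mul_comm t l, sub_add_eq_sub_sub] using ht

namespace IsTangentTube

variable {U : Set E} {μ : ℝ≥0} {C δ : ℝ}

lemma norm_unstableApprox_sub_le (hT : IsTangentTube G p v l U μ C δ) (hl : 1 < ‖l‖) (n : ℕ)
    {t : ℂ} (ht : ‖t‖ < δ) :
    ‖unstableApprox G p v l n t - (p + t • v)‖ ≤ C * ‖t‖ ^ 2 := by
  have hl0 : l ≠ 0 := norm_pos_iff.1 (one_pos.trans hl)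
  induction n generalizing t with
  | zero =>
    rw [unstableApprox_zero, sub_self, norm_zero]
    exact mul_nonneg hT.nonneg (sq_nonneg _)
  | succ n ih =>
    obtain ⟨s, rfl⟩ : ∃ s, t = l * s := ⟨t / l, (mul_div_cancel₀ _ hl0).symm⟩
    rw [norm_mul] at ht ⊢
    have hs : ‖s‖ < δ := (le_mul_of_one_le_left (norm_nonneg s) hl.le).trans_lt ht
    have hmem : unstableApprox G p v l n s ∈ Metric.closedBall (p + s • v) (C * ‖s‖ ^ 2) :=
      mem_closedBall_iff_norm.2 (ih hs)
    have hcenter := Metric.mem_closedBall_self (x := p + s • v) (dist_nonneg.trans hmem)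
    rw [unstableApprox_succ, mul_div_cancel_left₀ _ hl0]
    calc ‖G (unstableApprox G p v l n s) - (p + (l * s) • v)‖
        ≤ ‖G (unstableApprox G p v l n s) - G (p + s • v)‖
          + ‖G (p + s • v) - (p + (l * s) • v)‖ := norm_sub_le_norm_sub_add_norm_sub ..
      _ ≤ μ * (C * ‖s‖ ^ 2) + (‖l‖ ^ 2 - μ) * C * ‖s‖ ^ 2 := by
          refine add_le_add ((hT.lipschitzOnWith.norm_sub_le (hT.closedBall_subset s hs hmem)
            (hT.closedBall_subset s hs hcenter)).trans ?_) (hT.norm_sub_le s hs)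
          exact mul_le_mul_of_nonneg_left (ih hs) μ.2
      _ = C * (‖l‖ * ‖s‖) ^ 2 := by ring

lemma unstableApprox_mem (hT : IsTangentTube G p v l U μ C δ) (hl : 1 < ‖l‖) (n : ℕ)
    {t : ℂ} (ht : ‖t‖ < δ) : unstableApprox G p v l n t ∈ U :=
  hT.closedBall_subset t ht (mem_closedBall_iff_norm.2 (hT.norm_unstableApprox_sub_le hl n ht))

lemma dist_unstableApprox_succ_le (hT : IsTangentTube G p v l U μ C δ) (hl : 1 < ‖l‖) (n : ℕ)
    {t : ℂ} (ht : ‖t‖ < δ) :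
    dist (unstableApprox G p v l n t) (unstableApprox G p v l (n + 1) t)
      ≤ C * ‖t‖ ^ 2 * (μ / ‖l‖ ^ 2) ^ n := by
  induction n generalizing t with
  | zero =>
    rw [unstableApprox_zero, dist_comm, dist_eq_norm, pow_zero, mul_one]
    exact hT.norm_unstableApprox_sub_le hl 1 ht
  | succ n ih =>
    have hs : ‖t / l‖ < δ := by
      rw [norm_div]; exact (div_le_self (norm_nonneg t) hl.le).trans_lt ht
    rw [unstableApprox_succ, unstableApprox_succ]
    calc dist (G (unstableApprox G p v l n (t / l))) (G (unstableApprox G p v l (n + 1) (t / l)))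
        ≤ μ * dist (unstableApprox G p v l n (t / l)) (unstableApprox G p v l (n + 1) (t / l)) :=
          hT.lipschitzOnWith.dist_le_mul _ (hT.unstableApprox_mem hl _ hs) _
            (hT.unstableApprox_mem hl _ hs)
      _ ≤ μ * (C * ‖t / l‖ ^ 2 * (μ / ‖l‖ ^ 2) ^ n) := by gcongr; exact ih hs
      _ = C * ‖t‖ ^ 2 * (μ / ‖l‖ ^ 2) ^ (n + 1) := by rw [norm_div]; ring

lemma exists_differentiableOn_tendsto_unstableApprox [CompleteSpace E]
    (hT : IsTangentTube G p v l U μ C δ) (hG : Differentiable ℂ G) (hl : 1 < ‖l‖)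
    (hμ : (μ : ℝ) < ‖l‖ ^ 2) :
    ∃ f : ℂ → E, DifferentiableOn ℂ f (Metric.ball 0 δ) ∧
      ∀ t ∈ Metric.ball (0 : ℂ) δ,
        Tendsto (unstableApprox G p v l · t) atTop (𝓝 (f t)) := by
  set θ : ℝ := μ / ‖l‖ ^ 2
  have hθ1 : θ < 1 := (div_lt_one (by positivity)).2 hμ
  have hθ0 : 0 ≤ θ := by positivity
  have hdist (t : ℂ) (ht : t ∈ Metric.ball (0 : ℂ) δ) (n : ℕ) :=
    hT.dist_unstableApprox_succ_le hl n (mem_ball_zero_iff.1 ht)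
  have hlim (t : ℂ) : ∃ y, t ∈ Metric.ball (0 : ℂ) δ →
      Tendsto (unstableApprox G p v l · t) atTop (𝓝 y) := by
    by_cases ht : t ∈ Metric.ball (0 : ℂ) δ
    · obtain ⟨y, hy⟩ :=
        cauchySeq_tendsto_of_complete (cauchySeq_of_le_geometric _ _ hθ1 (hdist t ht))
      exact ⟨y, fun _ => hy⟩
    · exact ⟨0, fun h => absurd h ht⟩
  choose f hf using hlim
  refine ⟨f, ?_, hf⟩
  have hunif : TendstoUniformlyOn (unstableApprox G p v l) f atTop (Metric.ball 0 δ) := by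
    rw [Metric.tendstoUniformlyOn_iff]
    intro ε hε
    have hgeom : Tendsto (fun n : ℕ => C * δ ^ 2 * θ ^ n / (1 - θ)) atTop (𝓝 0) := by
      simpa using ((tendsto_pow_atTop_nhds_zero_of_lt_one hθ0 hθ1).const_mul
        (C * δ ^ 2)).div_const (1 - θ)
    filter_upwards [hgeom.eventually_lt_const hε] with n hn t ht
    rw [dist_comm]
    refine (dist_le_of_le_geometric_of_tendsto _ _ hθ1 (hdist t ht) (hf t ht) n).trans_lt
      (lt_of_le_of_lt ?_ hn)
    have := hT.nonneg
    have : ‖t‖ ≤ δ := (mem_ball_zero_iff.1 ht).le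
    have : 0 < 1 - θ := sub_pos.2 hθ1
    gcongr
  exact hunif.tendstoLocallyUniformlyOn.differentiableOn
    (Eventually.of_forall fun n => (differentiable_unstableApprox hG n).differentiableOn)
    Metric.isOpen_ball

end IsTangentTube

lemma hasDerivAt_zero_of_norm_sub_le {f : ℂ → E} {C : ℝ}
    (hf : ∀ᶠ t in 𝓝 0, ‖f t - (p + t • v)‖ ≤ C * ‖t‖ ^ 2) : HasDerivAt f v 0 := by
  have h0 : f 0 = p := by simpa [sub_eq_zero] using hf.self_of_nhds
  refine HasDerivAt.of_isLittleO ((Asymptotics.IsBigO.of_bound C ?_).trans_isLittleO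
    (Asymptotics.isLittleO_pow_sub_sub (0 : ℂ) one_lt_two))
  filter_upwards [hf] with t ht
  simpa [h0, sub_sub] using ht

theorem exists_differentiable_tendsto_unstableApprox [CompleteSpace E] {A : E →L[ℂ] E}
    (hG : Differentiable ℂ G) (hA : HasStrictFDerivAt G A p) (hp : G p = p) (hv : A v = l • v)
    (hl : 1 < ‖l‖) (hAl : ‖A‖ < ‖l‖ ^ 2) :
    ∃ f : ℂ → E, Differentiable ℂ f ∧ HasDerivAt f v 0 ∧
      ∀ t, Tendsto (unstableApprox G p v l · t) atTop (𝓝 (f t)) := by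
  obtain ⟨U, μ, C, δ, hT, hμ, hδ⟩ := exists_isTangentTube hG hA hp hv hAl
  obtain ⟨g, hg, hglim⟩ := hT.exists_differentiableOn_tendsto_unstableApprox hG hl hμ
  have hext (k : ℕ) (t : ℂ) (ht : t / l ^ k ∈ Metric.ball (0 : ℂ) δ) :
      Tendsto (unstableApprox G p v l · t) atTop (𝓝 (G^[k] (g (t / l ^ k)))) := by
    rw [← tendsto_add_atTop_iff_nat k]
    simp only [unstableApprox_add]
    exact ((hG.continuous.iterate k).tendsto _).comp (hglim _ ht)
  have hsmall (t : ℂ) : ∃ k : ℕ, t / l ^ k ∈ Metric.ball (0 : ℂ) δ :=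
    ((tendsto_div_pow_nhds_zero hl t).eventually_mem (Metric.ball_mem_nhds 0 hδ)).exists
  choose k hk using hsmall
  refine ⟨fun t => G^[k t] (g (t / l ^ k t)), fun t => ?_,
    hasDerivAt_zero_of_norm_sub_le (p := p) (C := C) ?_, fun t => hext _ t (hk t)⟩
  · have hscale : Differentiable ℂ fun s : ℂ => s / l ^ k t := differentiable_id.div_const _
    have hgt := hg.differentiableAt (Metric.isOpen_ball.mem_nhds (hk t))
    refine (((hG.iterate (k t)) _).comp t (hgt.comp t (hscale t))).congr_of_eventuallyEq ?_
    filter_upwards [hscale.continuous.continuousAt.eventually_mem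
      (Metric.isOpen_ball.mem_nhds (hk t))] with s hs
    exact tendsto_nhds_unique (hext _ s (hk s)) (hext _ s hs)
  · filter_upwards [Metric.ball_mem_nhds (0 : ℂ) hδ] with t ht
    exact le_of_tendsto ((hext _ t (hk t)).sub_const _).norm (Eventually.of_forall fun n =>
      hT.norm_unstableApprox_sub_le hl n (mem_ball_zero_iff.1 ht))

end Complex

/-- `σ` is Poincaré's parametrization of the unstable manifold of `F` at `p` for the eigenvector
`v` with eigenvalue `l`: a smooth curve through `p` with velocity `v` that conjugates `F` to the
multiplication by `l`. -/
structure IsUnstableParametrization {V : Type*} [NormedAddCommGroup V] [NormedSpace ℝ V]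
    (F : V → V) (p v : V) (l : ℝ) (σ : ℝ → V) : Prop where
  contDiff : ContDiff ℝ ∞ σ
  apply_zero : σ 0 = p
  hasDerivAt_zero : HasDerivAt σ v 0
  semiconj : Function.Semiconj σ (l * ·) F

section Real

variable {V : Type*} [NormedAddCommGroup V] [NormedSpace ℝ V] {F : V → V} {p v : V} {l : ℝ}
  {σ : ℝ → V}

lemma semiconj_of_tendsto_unstableApprox (hF : Continuous F) (hl : l ≠ 0)
    (hσ : ∀ t, Tendsto (unstableApprox F p v l · t) atTop (𝓝 (σ t))) :
    Function.Semiconj σ (l * ·) F := by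
  intro t
  refine tendsto_nhds_unique ((tendsto_add_atTop_iff_nat 1).2 (hσ (l * t))) ?_
  simp only [unstableApprox_succ, mul_div_cancel_left₀ t hl]
  exact (hF.tendsto _).comp (hσ t)

lemma apply_zero_of_tendsto_unstableApprox (hp : F p = p)
    (hσ : Tendsto (unstableApprox F p v l · 0) atTop (𝓝 (σ 0))) : σ 0 = p := by
  refine tendsto_nhds_unique hσ (tendsto_const_nhds.congr fun n => ?_)
  rw [unstableApprox, zero_div, zero_smul, add_zero, Function.iterate_fixed hp]

lemma apply_neg_of_tendsto_unstableApprox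
    (hF : Function.Commute F (Equiv.pointReflection p))
    (hσ : ∀ t, Tendsto (unstableApprox F p v l · t) atTop (𝓝 (σ t))) (t : ℝ) :
    σ (-t) = Equiv.pointReflection p (σ t) := by
  have hc : Continuous (Equiv.pointReflection p) :=
    (continuous_const.sub continuous_id).add continuous_const
  refine tendsto_nhds_unique (hσ (-t)) (((hc.tendsto _).comp (hσ t)).congr fun n => ?_)
  have hstart : p + (-t / l ^ n) • v = Equiv.pointReflection p (p + (t / l ^ n) • v) := by
    simp [Equiv.pointReflection_apply, neg_div, add_comm]
  simp only [unstableApprox, Function.comp_apply]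
  rw [hstart, (hF.iterate_left n).eq]

variable {E : Type*} [NormedAddCommGroup E] [NormedSpace ℂ E] {G : E → E}

lemma unstableApprox_complexify (ι : V →L[ℝ] E) (hFG : Function.Semiconj ι F G) (n : ℕ) (t : ℝ) :
    unstableApprox G (ι p) (ι v) (l : ℂ) n t = ι (unstableApprox F p v l n t) := by
  rw [unstableApprox, unstableApprox, (hFG.iterate_right n).eq, map_add, map_smul,
    ← Complex.ofReal_pow, ← Complex.ofReal_div, Complex.coe_smul]

theorem exists_isUnstableParametrization [CompleteSpace E] {A : E →L[ℂ] E} (ι : V →L[ℝ] E)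
    (R : E →L[ℝ] V) (hR : Function.LeftInverse R ι) (hFG : Function.Semiconj ι F G)
    (hG : Differentiable ℂ G) (hA : HasStrictFDerivAt G A (ι p)) (hp : F p = p)
    (hv : A (ι v) = (l : ℂ) • ι v) (hl : 1 < l) (hAl : ‖A‖ < l ^ 2) :
    ∃ σ : ℝ → V, IsUnstableParametrization F p v l σ ∧
      ∀ t, Tendsto (unstableApprox F p v l · t) atTop (𝓝 (σ t)) := by
  have hF : F = R ∘ G ∘ ι := funext fun z => by
    rw [Function.comp_apply, Function.comp_apply, ← hFG z, hR]
  have hnorm : ‖(l : ℂ)‖ = l := Complex.norm_of_nonneg (one_pos.trans hl).le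
  obtain ⟨f, hf, hf0, hlim⟩ := exists_differentiable_tendsto_unstableApprox hG hA
    (by rw [← hFG p, hp]) hv (by rwa [hnorm]) (by rwa [hnorm])
  have hσ (t : ℝ) : Tendsto (unstableApprox F p v l · t) atTop (𝓝 (R (f t))) := by
    refine ((R.continuous.tendsto _).comp (hlim t)).congr fun n => ?_
    rw [Function.comp_apply, unstableApprox_complexify ι hFG, hR]
  refine ⟨fun t => R (f t), ⟨?_,
    apply_zero_of_tendsto_unstableApprox (σ := fun t => R (f t)) hp (hσ 0), ?_,
    semiconj_of_tendsto_unstableApprox ?_ (one_pos.trans hl).ne' hσ⟩, hσ⟩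
  · exact R.contDiff.comp ((hf.contDiff.restrict_scalars ℝ).comp Complex.ofRealCLM.contDiff)
  · have h := HasDerivAt.scomp_of_eq (h := ((↑) : ℝ → ℂ)) 0 hf0 (hasDerivAt_id 0).ofReal_comp
      Complex.ofReal_zero.symm
    have h' := R.hasFDerivAt.comp_hasDerivAt 0 h
    rwa [Complex.ofReal_one, one_smul, hR] at h'
  · exact hF ▸ R.continuous.comp (hG.continuous.comp ι.continuous)

end Real

end LinearizingParametrization

section UnstableCurve

lemma eventually_eq_of_hasStrictDerivAt {V : Type*} [NormedAddCommGroup V] [NormedSpace ℝ V]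
    {σ : ℝ → V} {v : V} {x : ℝ} (hσ : HasStrictDerivAt σ v x) (hv : v ≠ 0) :
    ∀ᶠ q : ℝ × ℝ in 𝓝 (x, x), σ q.1 = σ q.2 → q.1 = q.2 := by
  filter_upwards [hσ.hasStrictFDerivAt.isLittleO.def (half_pos (norm_pos_iff.2 hv))] with q hq h
  simp only [h, sub_self, zero_sub, norm_neg, ContinuousLinearMap.toSpanSingleton_apply,
    norm_smul] at hq
  by_contra hne
  have : 0 < ‖q.1 - q.2‖ * ‖v‖ :=
    mul_pos (norm_pos_iff.2 (sub_ne_zero.2 hne)) (norm_pos_iff.2 hv)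
  linarith

namespace IsUnstableParametrization

section NormedSpace

variable {V : Type*} [NormedAddCommGroup V] [NormedSpace ℝ V] {F : V → V} {p v : V} {l : ℝ}
  {σ : ℝ → V}

lemma iterate_apply (hσ : IsUnstableParametrization F p v l σ) (n : ℕ) (t : ℝ) :
    F^[n] (σ t) = σ (l ^ n * t) := by
  rw [← (hσ.semiconj.iterate_right n).eq, mul_left_iterate]

lemma iterate_apply_div (hσ : IsUnstableParametrization F p v l σ) (hl : l ≠ 0) (n : ℕ) (t : ℝ) :
    F^[n] (σ (t / l ^ n)) = σ t := by
  rw [hσ.iterate_apply, mul_div_cancel₀ _ (pow_ne_zero n hl)]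

lemma apply_div_pow_succ (hσ : IsUnstableParametrization F p v l σ) (hl : l ≠ 0) (n : ℕ)
    (t : ℝ) : F (σ (t / l ^ (n + 1))) = σ (t / l ^ n) := by
  rw [← hσ.semiconj.eq, pow_succ, ← div_div, mul_div_cancel₀ _ hl]

lemma hasStrictDerivAt_zero (hσ : IsUnstableParametrization F p v l σ) :
    HasStrictDerivAt σ v 0 :=
  hσ.contDiff.contDiffAt.hasStrictDerivAt' hσ.hasDerivAt_zero (by simp)

lemma tendsto_apply_div_pow (hσ : IsUnstableParametrization F p v l σ) (hl : 1 < l) (t : ℝ) :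
    Tendsto (fun n : ℕ => σ (t / l ^ n)) atTop (𝓝 p) := by
  rw [← hσ.apply_zero]
  exact (hσ.contDiff.continuous.tendsto 0).comp
    (tendsto_div_pow_nhds_zero (hl.trans_le (le_abs_self l)) t)

lemma injective (hσ : IsUnstableParametrization F p v l σ) (hl : 1 < l) (hv : v ≠ 0)
    (hF : Function.Injective F) : Function.Injective σ := by
  intro s t hst
  have hl0 : l ≠ 0 := (one_pos.trans hl).ne'
  have hdiv (x : ℝ) := tendsto_div_pow_nhds_zero (hl.trans_le (le_abs_self l)) x
  obtain ⟨n, hn⟩ := (((hdiv s).prodMk_nhds (hdiv t)).eventually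
    (eventually_eq_of_hasStrictDerivAt hσ.hasStrictDerivAt_zero hv)).exists
  have heq : s / l ^ n = t / l ^ n :=
    hn (hF.iterate n (by rw [hσ.iterate_apply_div hl0, hσ.iterate_apply_div hl0, hst]))
  exact (div_left_inj' (pow_ne_zero n hl0)).1 heq

lemma deriv_eq_zero_of_deriv_mul_eq_zero (hσ : IsUnstableParametrization F p v l σ) {K : ℝ≥0}
    (hF : AntilipschitzWith K F) {s : ℝ} (hs : deriv σ (l * s) = 0) : deriv σ s = 0 := by
  have hd : HasDerivAt σ 0 (l * s) :=
    hs ▸ (hσ.contDiff.differentiable (by simp)).differentiableAt.hasDerivAt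
  refine HasDerivAt.deriv (HasDerivAt.of_isLittleO ?_)
  have hscale : Tendsto (l * ·) (𝓝 s) (𝓝 (l * s)) := (continuous_const_mul l).tendsto s
  have hlittle := hd.isLittleO.comp_tendsto hscale
  simp only [smul_zero, sub_zero, Function.comp_def] at hlittle ⊢
  have hback : (fun x => σ x - σ s) =O[𝓝 s] fun x => σ (l * x) - σ (l * s) :=
    Asymptotics.IsBigO.of_bound K (Eventually.of_forall fun x => by
      simpa only [hσ.semiconj.eq, dist_eq_norm] using hF.le_mul_dist (σ x) (σ s))
  refine hback.trans_isLittleO (hlittle.trans_isBigO ?_)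
  simpa only [mul_sub] using Asymptotics.isBigO_const_mul_self l (fun x => x - s) (𝓝 s)

lemma deriv_ne_zero (hσ : IsUnstableParametrization F p v l σ) (hl : 1 < l) (hv : v ≠ 0)
    {K : ℝ≥0} (hF : AntilipschitzWith K F) (t : ℝ) : deriv σ t ≠ 0 := by
  intro ht
  have hl0 : l ≠ 0 := (one_pos.trans hl).ne'
  have hzero (n : ℕ) : deriv σ (t / l ^ n) = 0 := by
    induction n with
    | zero => simpa using ht
    | succ n ih =>
      refine hσ.deriv_eq_zero_of_deriv_mul_eq_zero hF ?_
      rwa [pow_succ, ← div_div, mul_div_cancel₀ _ hl0]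
  have hlim := ((hσ.contDiff.continuous_deriv (by simp)).tendsto 0).comp
    (tendsto_div_pow_nhds_zero (hl.trans_le (le_abs_self l)) t)
  rw [hσ.hasDerivAt_zero.deriv] at hlim
  exact hv (tendsto_nhds_unique hlim (by simp only [Function.comp_def, hzero, tendsto_const_nhds]))

lemma apply_mem_of_le (hσ : IsUnstableParametrization F p v l σ) (hl : 1 < l) {S : Set V}
    (hS : Set.MapsTo F S S) {ε : ℝ} (hε : 0 < ε) (h : ∀ t ∈ Set.Ico ε (l * ε), σ t ∈ S)
    {t : ℝ} (ht : ε ≤ t) : σ t ∈ S := by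
  obtain ⟨n, hn, hn'⟩ := exists_nat_pow_near ((one_le_div hε).2 ht) hl
  have hpow : 0 < l ^ n := pow_pos (one_pos.trans hl) n
  rw [← hσ.iterate_apply_div (one_pos.trans hl).ne' n t]
  refine hS.iterate n (h _ ⟨?_, ?_⟩)
  · rwa [le_div_iff₀ hpow, mul_comm, ← le_div_iff₀ hε]
  · rwa [div_lt_iff₀ hpow, mul_right_comm, ← pow_succ', ← div_lt_iff₀ hε]

lemma tendsto_atTop (hσ : IsUnstableParametrization F p v l σ) (hl : 1 < l) {S : Set V} {q : V}
    (hS : TendstoUniformlyOn (fun n => F^[n]) (fun _ => q) atTop S) {ε : ℝ}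
    (h : ∀ t, ε ≤ t → σ t ∈ S) : Tendsto σ atTop (𝓝 q) := by
  refine Metric.tendsto_nhds.2 fun r hr => ?_
  obtain ⟨n, hn⟩ := (Metric.tendstoUniformlyOn_iff.1 hS r hr).exists
  filter_upwards [eventually_ge_atTop (ε * l ^ n)] with t ht
  rw [← hσ.iterate_apply_div (one_pos.trans hl).ne' n t, dist_comm]
  exact hn _ (h _ ((le_div_iff₀ (pow_pos (one_pos.trans hl) n)).2 ht))

end NormedSpace

section Plane

variable {F : ℝ × ℝ → ℝ × ℝ} {p v q : ℝ × ℝ} {l : ℝ} {σ : ℝ → ℝ × ℝ} {K : ℝ≥0}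

lemma range_subset_unstableSet (hσ : IsUnstableParametrization F p v l σ) (hl : 1 < l) :
    Set.range σ ⊆ unstableSet F p := by
  rintro _ ⟨t, rfl⟩
  exact ⟨fun n => σ (t / l ^ n), by simp, fun n => hσ.apply_div_pow_succ (one_pos.trans hl).ne' n t,
    hσ.tendsto_apply_div_pow hl t⟩

lemma isSmoothSimpleCurve (hσ : IsUnstableParametrization F p v l σ) (hl : 1 < l) (hv : v ≠ 0)
    (hF : AntilipschitzWith K F) : IsSmoothSimpleCurve σ :=
  ⟨hσ.contDiff, hσ.injective hl hv hF.injective, hσ.deriv_ne_zero hl hv hF⟩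

lemma image_image_Ioi (hσ : IsUnstableParametrization F p v l σ) (hl : 0 < l) :
    F '' (σ '' Set.Ioi 0) = σ '' Set.Ioi 0 := by
  rw [← hσ.semiconj.set_image.eq, Set.image_mul_left_Ioi hl, mul_zero]

lemma image_Ioi_subset_stableSet (hσ : IsUnstableParametrization F p v l σ) (hl : 1 < l)
    (hq : Tendsto σ atTop (𝓝 q)) : σ '' Set.Ioi 0 ⊆ stableSet F q := by
  rintro _ ⟨t, ht, rfl⟩
  exact (hq.comp ((tendsto_pow_atTop_atTop_of_one_lt hl).atTop_mul_const ht)).congr fun n =>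
    (hσ.iterate_apply n t).symm

lemma isHeteroclinicCurve (hσ : IsUnstableParametrization F p v l σ) (hl : 1 < l) (hv : v ≠ 0)
    (hF : AntilipschitzWith K F) (hq : Tendsto σ atTop (𝓝 q)) :
    IsHeteroclinicCurve F p q (σ '' Set.Ioi 0) := by
  obtain ⟨hsmooth, hinj, hderiv⟩ := hσ.isSmoothSimpleCurve hl hv hF
  refine ⟨hσ.image_image_Ioi (one_pos.trans hl), Set.subset_inter
    ((Set.image_subset_range σ _).trans (hσ.range_subset_unstableSet hl))
    (hσ.image_Ioi_subset_stableSet hl hq), σ ∘ Real.exp,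
    ⟨hsmooth.comp Real.contDiff_exp, hinj.comp Real.exp_injective, fun t => ?_⟩, ?_, ?_,
    hq.comp Real.tendsto_exp_atTop⟩
  · have hd := (hsmooth.differentiable (by simp)).differentiableAt.hasDerivAt.scomp t
      (Real.hasDerivAt_exp t)
    rw [hd.deriv]
    exact smul_ne_zero (Real.exp_ne_zero t) (hderiv _)
  · rw [Set.range_comp, Real.range_exp]
  · rw [← hσ.apply_zero]
    exact (hsmooth.continuous.tendsto 0).comp Real.tendsto_exp_atBot

lemma isUnstableBranch (hσ : IsUnstableParametrization F p v l σ) (hl : 1 < l) (hv : v ≠ 0)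
    (hF : AntilipschitzWith K F) (hrange : Set.range σ = unstableSet F p) :
    IsUnstableBranch F p v (σ '' Set.Ioi 0) :=
  ⟨σ, hσ.isSmoothSimpleCurve hl hv hF, hσ.apply_zero, hσ.hasDerivAt_zero.deriv, hrange, rfl⟩

end Plane

end IsUnstableParametrization

end UnstableCurve

section UnstableSet

variable {V X Y : Type*} [NormedAddCommGroup V] [NormedSpace ℝ V] [NormedAddCommGroup X]
  [NormedSpace ℝ X] [NormedAddCommGroup Y] [NormedSpace ℝ Y] {F : V → V} {p : V}

/-- In the coordinates `e = (ξ, η)` of an unstable and a stable direction, `F⁻¹` maps the stable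
cones `‖ξ‖ ≤ ‖η‖` of `U` into themselves and does not decrease `‖η‖` there. The condition is
stated without an inverse of `F`. -/
def PreservesStableCones (F : V → V) (e : V ≃L[ℝ] X × Y) (U : Set V) : Prop :=
  ∀ z ∈ U, ∀ w ∈ U, ‖(e (F z - F w)).1‖ ≤ ‖(e (F z - F w)).2‖ →
    ‖(e (z - w)).1‖ ≤ ‖(e (z - w)).2‖ ∧ ‖(e (F z - F w)).2‖ ≤ ‖(e (z - w)).2‖

lemma exists_preservesStableCones {A : V →L[ℝ] V} (hF : HasStrictFDerivAt F A p)
    (e : V ≃L[ℝ] X × Y) {κ : ℝ} {μ : ℝ≥0} (hμκ : μ < κ) (hμ : μ < 1)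
    (hX : ∀ u, κ * ‖(e u).1‖ ≤ ‖(e (A u)).1‖) (hY : ∀ u, ‖(e (A u)).2‖ ≤ μ * ‖(e u).2‖) :
    ∃ U ∈ 𝓝 p, PreservesStableCones F e U := by
  obtain ⟨ε, hε0, hε⟩ : ∃ ε > 0, ε < min ((κ - μ) / 2) (1 - μ) :=
    exists_between (lt_min (half_pos (sub_pos.2 hμκ)) (sub_pos.2 (by exact_mod_cast hμ)))
  obtain ⟨hεκ, hεμ⟩ := lt_min_iff.1 hε
  have hlin : (fun q : V × V => e (F q.1 - F q.2 - A (q.1 - q.2)))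
      =o[𝓝 (p, p)] fun q : V × V => e (q.1 - q.2) :=
    (e.isBigO_comp _ _).trans_isLittleO
      (hF.isLittleO.trans_isBigO (e.isBigO_comp_rev (fun q : V × V => q.1 - q.2) _))
  obtain ⟨U, hU, hUε⟩ := mem_nhds_prod_iff.1 (hlin.def hε0)
  obtain ⟨W, hW, hUW⟩ := hUε
  refine ⟨U ∩ W, inter_mem hU hW, fun z hz w hw hcone => ?_⟩
  have hrem := hUW (Set.mk_mem_prod hz.1 hw.2)
  simp only [Set.mem_ofPred_eq, map_sub e (F z - F w), Prod.norm_def (e (z - w))] at hrem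
  have hrem1 := (norm_fst_le _).trans hrem
  have hrem2 := (norm_snd_le _).trans hrem
  have hξ := (norm_sub_norm_le (e (A (z - w))).1 (e (F z - F w)).1).trans
    ((norm_sub_rev _ _).le.trans hrem1)
  have hη := (norm_sub_norm_le (e (F z - F w)).2 (e (A (z - w))).2).trans hrem2
  have hX' := hX (z - w)
  have hY' := hY (z - w)
  have hback : ‖(e (z - w)).1‖ ≤ ‖(e (z - w)).2‖ := by
    by_contra! hlt
    rw [max_eq_left hlt.le] at hξ hη
    nlinarith [mul_le_mul_of_nonneg_left hlt.le μ.2, norm_nonneg (e (z - w)).2]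
  rw [max_eq_right hback] at hη
  exact ⟨hback, by nlinarith [norm_nonneg (e (z - w)).2]⟩

namespace PreservesStableCones

variable {e : V ≃L[ℝ] X × Y} {U : Set V}

lemma eq_of_backward_orbits (hU : PreservesStableCones F e U) {x y : ℕ → V}
    (hxU : ∀ n, x n ∈ U) (hyU : ∀ n, y n ∈ U) (hx : ∀ n, F (x (n + 1)) = x n)
    (hy : ∀ n, F (y (n + 1)) = y n) (hxp : Tendsto x atTop (𝓝 p)) (hyp : Tendsto y atTop (𝓝 p))
    (h0 : (e (x 0)).1 = (e (y 0)).1) : x 0 = y 0 := by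
  have hξ0 : (e (x 0 - y 0)).1 = 0 := by rw [map_sub, Prod.fst_sub, h0, sub_self]
  have hcone (n : ℕ) : ‖(e (x n - y n)).1‖ ≤ ‖(e (x n - y n)).2‖ ∧
      ‖(e (x 0 - y 0)).2‖ ≤ ‖(e (x n - y n)).2‖ := by
    induction n with
    | zero => exact ⟨by rw [hξ0, norm_zero]; exact norm_nonneg _, le_rfl⟩
    | succ n ih =>
      have hstep := hU _ (hxU (n + 1)) _ (hyU (n + 1))
      rw [hx, hy] at hstep
      exact ⟨(hstep ih.1).1, ih.2.trans (hstep ih.1).2⟩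
  have hlim : Tendsto (fun n => ‖(e (x n - y n)).2‖) atTop (𝓝 0) := by
    have hc : Continuous fun u => ‖(e u).2‖ := by fun_prop
    have h := (hc.tendsto _).comp (hxp.sub hyp)
    rwa [sub_self, map_zero, Prod.snd_zero, norm_zero] at h
  have hη0 : (e (x 0 - y 0)).2 = 0 :=
    norm_le_zero_iff.1 (ge_of_tendsto' hlim fun n => (hcone n).2)
  exact sub_eq_zero.1 (e.map_eq_zero_iff.1 (Prod.ext hξ0 hη0))

end PreservesStableCones

lemma iterate_backward_orbit {α : Type*} {f : α → α} {x : ℕ → α} (hx : ∀ n, f (x (n + 1)) = x n)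
    (n : ℕ) : f^[n] (x n) = x 0 := by
  induction n with
  | zero => rfl
  | succ n ih => rw [Function.iterate_succ_apply, hx, ih]

lemma IsUnstableParametrization.mem_range_of_backward_orbit {v : V} {l : ℝ} {σ : ℝ → V}
    (hσ : IsUnstableParametrization F p v l σ) (hl : 1 < l) {e : V ≃L[ℝ] ℝ × Y} (hv : (e v).1 ≠ 0)
    {U : Set V} (hU : U ∈ 𝓝 p) (hUF : PreservesStableCones F e U) {x : ℕ → V}
    (hx : ∀ n, F (x (n + 1)) = x n) (hxp : Tendsto x atTop (𝓝 p)) : x 0 ∈ Set.range σ := by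
  have hl0 : l ≠ 0 := (one_pos.trans hl).ne'
  have hσU : σ ⁻¹' U ∈ 𝓝 0 := hσ.contDiff.continuous.continuousAt (by rwa [hσ.apply_zero])
  obtain ⟨δ, hδ, hδU⟩ := Metric.mem_nhds_iff.1 hσU
  have hξσ : HasStrictDerivAt (fun t => (e (σ t)).1) (e v).1 0 :=
    ((ContinuousLinearMap.fst ℝ ℝ Y).comp e.toContinuousLinearMap).hasStrictFDerivAt
      |>.comp_hasStrictDerivAt 0 hσ.hasStrictDerivAt_zero
  have himage : (fun t => (e (σ t)).1) '' Metric.ball 0 δ ∈ 𝓝 (e p).1 := by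
    have := hξσ.map_nhds_eq hv
    rw [hσ.apply_zero] at this
    exact this ▸ image_mem_map (Metric.ball_mem_nhds 0 hδ)
  have hξx : Tendsto (fun n => (e (x n)).1) atTop (𝓝 (e p).1) :=
    ((continuous_fst.comp e.continuous).tendsto p).comp hxp
  obtain ⟨N, hN⟩ := eventually_atTop.1
    ((hξx.eventually_mem himage).and (hxp.eventually_mem hU))
  obtain ⟨s, hs, hsx⟩ := (hN N le_rfl).1
  have hsU (k : ℕ) : σ (s / l ^ k) ∈ U := by
    refine hδU (mem_ball_zero_iff.2 (lt_of_le_of_lt ?_ (mem_ball_zero_iff.1 hs)))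
    rw [norm_div, norm_pow]
    exact div_le_self (norm_nonneg s) (one_le_pow₀ (hl.le.trans (le_abs_self l)))
  have hxN : x N = σ s := by
    simpa using hUF.eq_of_backward_orbits (x := fun k => x (N + k)) (y := fun k => σ (s / l ^ k))
      (fun k => (hN _ (Nat.le_add_right N k)).2) hsU (fun k => hx (N + k))
      (hσ.apply_div_pow_succ hl0 · s)
      (hxp.comp ((tendsto_add_atTop_nat N).congr fun k => add_comm k N))
      (hσ.tendsto_apply_div_pow hl s) (by simpa using hsx.symm)
  exact ⟨l ^ N * s, by rw [← hσ.iterate_apply, ← hxN, iterate_backward_orbit hx]⟩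

lemma IsUnstableParametrization.range_eq_unstableSet {F : ℝ × ℝ → ℝ × ℝ} {p v : ℝ × ℝ} {l : ℝ}
    {σ : ℝ → ℝ × ℝ} (hσ : IsUnstableParametrization F p v l σ) (hl : 1 < l)
    {e : (ℝ × ℝ) ≃L[ℝ] ℝ × Y} (hv : (e v).1 ≠ 0) {U : Set (ℝ × ℝ)} (hU : U ∈ 𝓝 p)
    (hUF : PreservesStableCones F e U) : Set.range σ = unstableSet F p := by
  refine (hσ.range_subset_unstableSet hl).antisymm ?_
  rintro _ ⟨x, rfl, hx, hxp⟩
  exact hσ.mem_range_of_backward_orbit hl hv hU hUF hx hxp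

end UnstableSet

section ClockMap

open Real

lemma antilipschitzWith_clockMap {a : ℝ} (ha0 : 0 ≤ a) (ha : a < 1 / 3) :
    ∃ K, AntilipschitzWith K (clockMap a) := by
  let g : ℝ × ℝ → ℝ × ℝ := fun z =>
    (2 * a * sin z.1 + a * sin z.2, a * sin z.1 + 2 * a * sin z.2)
  have hg : LipschitzWith (3 * a).toNNReal g := by
    refine LipschitzWith.of_dist_le_mul fun z w => ?_
    have h1 := (abs_sin_sub_sin_le z.1 w.1).trans (le_max_left (dist z.1 w.1) (dist z.2 w.2))
    have h2 := (abs_sin_sub_sin_le z.2 w.2).trans (le_max_right (dist z.1 w.1) (dist z.2 w.2))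
    rw [abs_le] at h1 h2
    rw [Prod.dist_eq (x := z), Prod.dist_eq, coe_toNNReal _ (by positivity)]
    refine max_le (abs_le.2 ⟨?_, ?_⟩) (abs_le.2 ⟨?_, ?_⟩) <;> simp only [g] <;> nlinarith
  have hsum : clockMap a = fun z => z + g z := by
    ext z <;> simp only [clockMap, g, Prod.fst_add, Prod.snd_add] <;> ring
  rw [hsum]
  exact ⟨_, AntilipschitzWith.id.add_lipschitzWith hg
    (by rw [inv_one, toNNReal_lt_one]; linarith)⟩

lemma commute_clockMap_pointReflection (a : ℝ) :
    Function.Commute (clockMap a) (Equiv.pointReflection (π, 0)) := by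
  intro z
  simp only [clockMap, Equiv.pointReflection_apply, vsub_eq_sub, vadd_eq_add, Prod.fst_sub,
    Prod.fst_add, Prod.snd_sub, Prod.snd_add, Prod.mk_sub_mk, Prod.mk_add_mk, Prod.mk.injEq]
  simp only [sub_add_eq_add_sub, ← two_mul, sin_two_pi_sub, zero_sub, add_zero, sin_neg]
  constructor <;> ring

section Multipliers

/-- The Jacobian matrix of `clockMap a` at `z`. -/
noncomputable def clockJacobian (a : ℝ) (z : ℝ × ℝ) : Matrix (Fin 2) (Fin 2) ℝ :=
  !![1 + 2 * a * cos z.1, a * cos z.2; a * cos z.1, 1 + 2 * a * cos z.2]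

lemma hasStrictFDerivAt_clockMap (a : ℝ) (z : ℝ × ℝ) :
    HasStrictFDerivAt (clockMap a) (Matrix.toLin (.finTwoProd ℝ) (.finTwoProd ℝ)
      (clockJacobian a z)).toContinuousLinearMap z := by
  have hfst := (hasStrictFDerivAt_fst (𝕜 := ℝ) (p := z))
  have hsnd := (hasStrictFDerivAt_snd (𝕜 := ℝ) (p := z))
  refine (((hfst.add (hfst.sin.const_mul (2 * a))).add (hsnd.sin.const_mul a)).prodMk
    ((hsnd.add (hfst.sin.const_mul a)).add (hsnd.sin.const_mul (2 * a)))).congr_fderiv ?_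
  rw [clockJacobian, Matrix.toLin_finTwoProd_toContinuousLinearMap]
  ext <;> simp

lemma charpoly_fderiv_clockMap (a : ℝ) (z : ℝ × ℝ) :
    LinearMap.charpoly (fderiv ℝ (clockMap a) z : (ℝ × ℝ) →ₗ[ℝ] (ℝ × ℝ))
      = (clockJacobian a z).charpoly := by
  rw [(hasStrictFDerivAt_clockMap a z).hasFDerivAt.fderiv,
    ← LinearMap.charpoly_toMatrix _ (.finTwoProd ℝ), LinearMap.coe_toContinuousLinearMap,
    LinearMap.toMatrix_toLin]

lemma mem_multipliers_clockMap {a r s : ℝ} {z : ℝ × ℝ} {μ : ℂ}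
    (htrace : (clockJacobian a z).trace = r + s) (hdet : (clockJacobian a z).det = r * s) :
    μ ∈ multipliers (clockMap a) z ↔ μ = r ∨ μ = s := by
  have hfactor : (clockJacobian a z).charpoly
      = (Polynomial.X - Polynomial.C r) * (Polynomial.X - Polynomial.C s) := by
    rw [Matrix.charpoly_fin_two, htrace, hdet, map_add, map_mul]; ring
  rw [multipliers, charpoly_fderiv_clockMap, hfactor, Polynomial.aroots_mul (mul_ne_zero
    (Polynomial.X_sub_C_ne_zero r) (Polynomial.X_sub_C_ne_zero s)), Polynomial.aroots_X_sub_C,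
    Polynomial.aroots_X_sub_C, Multiset.mem_add, Multiset.mem_singleton, Multiset.mem_singleton]
  rfl

lemma isSaddle_clockMap {a : ℝ} (ha0 : 0 < a) (ha : a < 1) : IsSaddle (clockMap a) (π, 0) := by
  have hsqrt : √3 ^ 2 = 3 := sq_sqrt (by norm_num)
  have hmem (μ : ℂ) : μ ∈ multipliers (clockMap a) (π, 0) ↔
      μ = ((1 - √3 * a : ℝ) : ℂ) ∨ μ = ((1 + √3 * a : ℝ) : ℂ) := by
    refine mem_multipliers_clockMap ?_ ?_
    · simp only [clockJacobian, Matrix.trace_fin_two_of, cos_pi, cos_zero]; ring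
    · simp only [clockJacobian, Matrix.det_fin_two_of, cos_pi, cos_zero]
      linear_combination a ^ 2 * hsqrt
  have hpos : 0 < √3 * a := by positivity
  have hlt : √3 * a < 2 := by nlinarith [sqrt_nonneg 3]
  refine ⟨by simp [clockMap], (hasStrictFDerivAt_clockMap a _).differentiableAt,
    ⟨_, (hmem _).2 (.inl rfl), ?_⟩, ⟨_, (hmem _).2 (.inr rfl), ?_⟩⟩
  · rw [Complex.norm_real, norm_eq_abs, abs_lt]
    constructor <;> linarith
  · rw [Complex.norm_real, norm_eq_abs, abs_of_pos (by positivity)]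
    linarith

lemma isSink_clockMap {a : ℝ} (ha0 : 0 < a) (ha : a < 2 / 3) : IsSink (clockMap a) (π, π) := by
  refine ⟨by simp [clockMap], (hasStrictFDerivAt_clockMap a _).differentiableAt, fun μ hμ => ?_⟩
  have hmem : μ = ((1 - a : ℝ) : ℂ) ∨ μ = ((1 - 3 * a : ℝ) : ℂ) := by
    refine (mem_multipliers_clockMap ?_ ?_).1 hμ
    · simp only [clockJacobian, Matrix.trace_fin_two_of, cos_pi]; ring
    · simp only [clockJacobian, Matrix.det_fin_two_of, cos_pi]; ring
  rcases hmem with rfl | rfl <;> rw [Complex.norm_real, norm_eq_abs, abs_lt] <;>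
    constructor <;> linarith

end Multipliers

section Saddle

/-- The eigenvalue of modulus greater than one of `clockMap a` at the saddle `(π, 0)`. -/
noncomputable def unstableEigenvalue (a : ℝ) : ℝ := 1 + √3 * a

lemma one_lt_unstableEigenvalue {a : ℝ} (ha : 0 < a) : 1 < unstableEigenvalue a :=
  lt_add_of_pos_right 1 (by positivity)

/-- The coordinates `(ξ, η)` that diagonalize the derivative of `clockMap a` at `(π, 0)`: its
left eigenvectors for the eigenvalues `1 + √3 a` and `1 - √3 a`. -/
noncomputable def saddleCoords : (ℝ × ℝ) ≃L[ℝ] ℝ × ℝ :=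
  LinearEquiv.toContinuousLinearEquiv
    { toFun u := ((2 + √3) * u.2 - u.1, (2 - √3) * u.2 - u.1)
      map_add' u w := by ext <;> simp only [Prod.fst_add, Prod.snd_add] <;> ring
      map_smul' c u := by
        ext <;> simp only [Prod.smul_fst, Prod.smul_snd, smul_eq_mul, RingHom.id_apply] <;> ring
      invFun w := ((2 + √3) * ((w.1 - w.2) / (2 * √3)) - w.1, (w.1 - w.2) / (2 * √3))
      left_inv u := by ext <;> field_simp <;> ring
      right_inv w := by ext <;> field_simp <;> ring }

lemma saddleCoords_apply (u : ℝ × ℝ) :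
    saddleCoords u = ((2 + √3) * u.2 - u.1, (2 - √3) * u.2 - u.1) := rfl

lemma saddleCoords_eigenvector_fst_ne_zero : (saddleCoords (2 - √3, 1)).1 ≠ 0 := by
  rw [saddleCoords_apply, show (2 + √3) * 1 - (2 - √3) = 2 * √3 by ring]
  positivity

lemma saddleCoords_clockJacobian (a : ℝ) (u : ℝ × ℝ) :
    saddleCoords (Matrix.toLin (.finTwoProd ℝ) (.finTwoProd ℝ) (clockJacobian a (π, 0)) u)
      = (unstableEigenvalue a * (saddleCoords u).1, (1 - √3 * a) * (saddleCoords u).2) := by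
  have hsqrt : √3 ^ 2 = 3 := sq_sqrt (by norm_num)
  rw [clockJacobian, Matrix.toLin_finTwoProd_apply]
  simp only [saddleCoords_apply, unstableEigenvalue, cos_pi, cos_zero, Prod.mk.injEq]
  constructor <;> linear_combination -(a * u.2) * hsqrt

lemma exists_preservesStableCones_clockMap {a : ℝ} (ha0 : 0 < a) (ha : a < 1) :
    ∃ U ∈ 𝓝 (π, 0), PreservesStableCones (clockMap a) saddleCoords U := by
  have hpos : 0 < √3 * a := by positivity
  have hlt : √3 * a < 2 := by nlinarith [sqrt_nonneg 3, sq_sqrt (show (0 : ℝ) ≤ 3 by norm_num)]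
  have hl := one_lt_unstableEigenvalue ha0
  have hμ : ‖1 - √3 * a‖₊ < 1 := by
    rw [← NNReal.coe_lt_coe, coe_nnnorm, norm_eq_abs, NNReal.coe_one, abs_lt]
    constructor <;> linarith
  refine exists_preservesStableCones (hasStrictFDerivAt_clockMap a (π, 0)) saddleCoords
    (κ := unstableEigenvalue a) (μ := ‖1 - √3 * a‖₊) (lt_trans (by exact_mod_cast hμ) hl) hμ
    (fun u => ?_) (fun u => ?_) <;>
  rw [LinearMap.coe_toContinuousLinearMap', saddleCoords_clockJacobian, norm_mul]
  · rw [norm_of_nonneg (one_pos.trans hl).le]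
  · rw [coe_nnnorm]

/-- The inclusion of the real plane into `ℂ × ℂ`. -/
noncomputable def complexify : ℝ × ℝ →L[ℝ] ℂ × ℂ :=
  Complex.ofRealCLM.prodMap Complex.ofRealCLM

lemma complexify_apply (z : ℝ × ℝ) : complexify z = (↑z.1, ↑z.2) := rfl

/-- The holomorphic extension of `clockMap a` to `ℂ × ℂ`. -/
noncomputable def complexClockMap (a : ℝ) (z : ℂ × ℂ) : ℂ × ℂ :=
  (z.1 + 2 * a * Complex.sin z.1 + a * Complex.sin z.2,
   z.2 + a * Complex.sin z.1 + 2 * a * Complex.sin z.2)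

lemma semiconj_complexClockMap (a : ℝ) :
    Function.Semiconj complexify (clockMap a) (complexClockMap a) := by
  intro z
  simp [complexify_apply, clockMap, complexClockMap]

lemma differentiable_complexClockMap (a : ℝ) : Differentiable ℂ (complexClockMap a) := by
  unfold complexClockMap; fun_prop

/-- The derivative of `complexClockMap a` at `(π, 0)`. -/
noncomputable def complexSaddleDeriv (a : ℝ) : ℂ × ℂ →L[ℂ] ℂ × ℂ :=
  ((1 - 2 * a : ℂ) • ContinuousLinearMap.fst ℂ ℂ ℂ + (a : ℂ) • ContinuousLinearMap.snd ℂ ℂ ℂ).prod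
    ((-a : ℂ) • ContinuousLinearMap.fst ℂ ℂ ℂ + (1 + 2 * a : ℂ) • ContinuousLinearMap.snd ℂ ℂ ℂ)

lemma hasStrictFDerivAt_complexClockMap (a : ℝ) :
    HasStrictFDerivAt (complexClockMap a) (complexSaddleDeriv a) (complexify (π, 0)) := by
  have hfst := (hasStrictFDerivAt_fst (𝕜 := ℂ) (p := complexify (π, 0)))
  have hsnd := (hasStrictFDerivAt_snd (𝕜 := ℂ) (p := complexify (π, 0)))
  refine (((hfst.add (hfst.csin.const_mul (2 * a : ℂ))).add (hsnd.csin.const_mul (a : ℂ))).prodMk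
    ((hsnd.add (hfst.csin.const_mul (a : ℂ))).add
      (hsnd.csin.const_mul (2 * a : ℂ)))).congr_fderiv ?_
  rw [complexSaddleDeriv]
  ext <;> simp [complexify_apply, sub_eq_add_neg]

lemma norm_complexSaddleDeriv_le {a : ℝ} (ha : 0 ≤ a) : ‖complexSaddleDeriv a‖ ≤ 1 + 3 * a := by
  refine ContinuousLinearMap.opNorm_le_bound _ (by positivity) fun u => ?_
  have hrow {b c : ℂ} (hb : ‖b‖ + ‖c‖ ≤ 1 + 3 * a) :
      ‖b * u.1 + c * u.2‖ ≤ (1 + 3 * a) * ‖u‖ := by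
    calc ‖b * u.1 + c * u.2‖ ≤ ‖b‖ * ‖u.1‖ + ‖c‖ * ‖u.2‖ := by
          simpa only [norm_mul] using norm_add_le (b * u.1) (c * u.2)
      _ ≤ ‖b‖ * ‖u‖ + ‖c‖ * ‖u‖ := by gcongr; exacts [norm_fst_le u, norm_snd_le u]
      _ = (‖b‖ + ‖c‖) * ‖u‖ := (add_mul ..).symm
      _ ≤ (1 + 3 * a) * ‖u‖ := by gcongr
  have hnorm : ‖(a : ℂ)‖ = a := Complex.norm_of_nonneg ha
  have htwo : ‖(2 * a : ℂ)‖ = 2 * a := by rw [norm_mul, hnorm, Complex.norm_two]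
  refine max_le (hrow (b := 1 - 2 * a) (c := a) ?_) (hrow (b := -a) (c := 1 + 2 * a) ?_)
  · have := norm_sub_le (1 : ℂ) (2 * a)
    rw [norm_one] at this
    linarith
  · have := norm_add_le (1 : ℂ) (2 * a)
    rw [norm_one] at this
    rw [norm_neg]
    linarith

lemma complexSaddleDeriv_eigenvector (a : ℝ) :
    complexSaddleDeriv a (complexify (2 - √3, 1))
      = (unstableEigenvalue a : ℂ) • complexify (2 - √3, 1) := by
  have hsqrt : (√3 : ℂ) ^ 2 = 3 := by exact_mod_cast sq_sqrt (show (0 : ℝ) ≤ 3 by norm_num)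
  refine Prod.ext ?_ ?_
  · suffices (1 - 2 * a) * (2 - √3) + a = (1 + √3 * a) * (2 - √3 : ℂ) by
      simpa [complexSaddleDeriv, unstableEigenvalue, complexify_apply] using this
    linear_combination a * hsqrt
  · suffices -(a * (2 - √3)) + (1 + 2 * a) = (1 + √3 * a : ℂ) by
      simpa [complexSaddleDeriv, unstableEigenvalue, complexify_apply] using this
    ring

lemma exists_isUnstableParametrization_clockMap {a : ℝ} (ha : 0 < a) :
    ∃ σ, IsUnstableParametrization (clockMap a) (π, 0) (2 - √3, 1) (unstableEigenvalue a) σ ∧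
      ∀ t, σ (-t) = Equiv.pointReflection (π, 0) (σ t) := by
  have hnorm : ‖complexSaddleDeriv a‖ < unstableEigenvalue a ^ 2 :=
    (norm_complexSaddleDeriv_le ha.le).trans_lt (by
      rw [unstableEigenvalue]
      nlinarith [lt_sqrt_of_sq_lt (show (3 / 2 : ℝ) ^ 2 < 3 by norm_num), sq_nonneg (√3 * a)])
  obtain ⟨σ, hσ, hlim⟩ := exists_isUnstableParametrization complexify
    (Complex.reCLM.prodMap Complex.reCLM) (fun _ => rfl) (semiconj_complexClockMap a)
    (differentiable_complexClockMap a) (hasStrictFDerivAt_complexClockMap a) (by simp [clockMap])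
    (complexSaddleDeriv_eigenvector a) (one_lt_unstableEigenvalue ha) hnorm
  exact ⟨σ, hσ, apply_neg_of_tendsto_unstableApprox (commute_clockMap_pointReflection a) hlim⟩

end Saddle

section Square

/-- Coordinates along the sides of `smallSquare`, in which it is `[0, π / 2] × [0, π / 2]`, with
the saddle `(π, 0)` at the origin and the sink `(π, π)` at the opposite corner. -/
noncomputable def sideCoords : (ℝ × ℝ) ≃ (ℝ × ℝ) where
  toFun z := ((z.2 - z.1 + π) / 2, (z.1 + z.2 - π) / 2)
  invFun w := (π - w.1 + w.2, w.1 + w.2)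
  left_inv z := by ext <;> ring
  right_inv w := by ext <;> ring

lemma sideCoords_apply (z : ℝ × ℝ) :
    sideCoords z = ((z.2 - z.1 + π) / 2, (z.1 + z.2 - π) / 2) := rfl

lemma sideCoords_symm_apply (w : ℝ × ℝ) :
    sideCoords.symm w = (π - w.1 + w.2, w.1 + w.2) := rfl

lemma uniformContinuous_sideCoords_symm : UniformContinuous sideCoords.symm :=
  ((uniformContinuous_const.sub uniformContinuous_fst).add uniformContinuous_snd).prodMk
    (uniformContinuous_fst.add uniformContinuous_snd)

lemma sideCoords_pointReflection (z : ℝ × ℝ) :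
    sideCoords (Equiv.pointReflection (π, 0) z) = -sideCoords z := by
  ext <;> simp only [sideCoords_apply, Equiv.pointReflection_apply, vsub_eq_sub, vadd_eq_add,
    Prod.fst_sub, Prod.snd_sub, Prod.fst_add, Prod.snd_add, Prod.fst_neg, Prod.snd_neg] <;> ring

lemma mem_smallSquare_iff {z : ℝ × ℝ} :
    z ∈ smallSquare ↔ sideCoords z ∈ Set.Icc 0 (π / 2, π / 2) := by
  simp only [smallSquare, Set.mem_ofPred_eq, sideCoords_apply, Set.mem_Icc, Prod.le_def,
    Prod.fst_zero, Prod.snd_zero]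
  constructor
  · rintro ⟨h₁, h₂, h₃, h₄⟩
    refine ⟨⟨?_, ?_⟩, ?_, ?_⟩ <;> linarith
  · rintro ⟨⟨h₁, h₂⟩, h₃, h₄⟩
    refine ⟨?_, ?_, ?_, ?_⟩ <;> linarith

/-- The map `clockMap a` in the coordinates `sideCoords`. -/
noncomputable def sideMap (a : ℝ) (w : ℝ × ℝ) : ℝ × ℝ :=
  (w.1 + a * (sin w.2 * cos w.1), w.2 + 3 * a * (sin w.1 * cos w.2))

lemma semiconj_sideMap (a : ℝ) : Function.Semiconj sideCoords (clockMap a) (sideMap a) := by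
  intro z
  obtain ⟨w, rfl⟩ := sideCoords.symm.surjective z
  have hx : sin (π - w.1 + w.2) = sin w.1 * cos w.2 - cos w.1 * sin w.2 := by
    rw [sub_add, sin_pi_sub, sin_sub]
  have hy := sin_add w.1 w.2
  rw [Equiv.apply_symm_apply, sideCoords_symm_apply, clockMap, sideCoords_apply, sideMap, hx, hy]
  ext <;> ring

section Interval

variable {k m u w : ℝ}

lemma le_add_mul_sin_mul_cos (hk : 0 ≤ k) (hu : u ∈ Set.Icc 0 (π / 2))
    (hw : w ∈ Set.Icc 0 (π / 2)) : u ≤ u + k * (sin w * cos u) :=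
  le_add_of_nonneg_right (mul_nonneg hk (mul_nonneg
    (sin_nonneg_of_nonneg_of_le_pi hw.1 (by linarith [hw.2, pi_pos]))
    (cos_nonneg_of_neg_pi_div_two_le_of_le (by linarith [hu.1, pi_pos]) hu.2)))

lemma add_mul_sin_mul_cos_le (hk : 0 ≤ k) (hk1 : k ≤ 1) (hu : u ∈ Set.Icc 0 (π / 2)) :
    u + k * (sin w * cos u) ≤ π / 2 := by
  have hcos0 : 0 ≤ cos u :=
    cos_nonneg_of_neg_pi_div_two_le_of_le (by linarith [hu.1, pi_pos]) hu.2
  have hcos : cos u ≤ π / 2 - u := by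
    rw [← sin_pi_div_two_sub]
    exact sin_le (sub_nonneg.2 hu.2)
  have hle : k * (sin w * cos u) ≤ cos u :=
    calc k * (sin w * cos u) ≤ k * cos u :=
          mul_le_mul_of_nonneg_left (mul_le_of_le_one_left hcos0 (sin_le_one w)) hk
      _ ≤ cos u := mul_le_of_le_one_left hcos0 hk1
  linarith

lemma pi_div_two_sub_add_mul_sin_mul_cos_le (hk : 0 ≤ k) (hm : 0 ≤ m)
    (hu : u ∈ Set.Icc 0 (π / 2)) (hw : w ∈ Set.Icc m (π / 2)) :
    π / 2 - (u + k * (sin w * cos u)) ≤ (1 - k * sin m * (2 / π)) * (π / 2 - u) := by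
  have hsin : sin m ≤ sin w := sin_le_sin_of_le_of_le_pi_div_two (by linarith [pi_pos]) hw.2 hw.1
  have hsin0 : 0 ≤ sin m := sin_nonneg_of_nonneg_of_le_pi hm (by linarith [hw.1, hw.2, pi_pos])
  have hcos : 2 / π * (π / 2 - u) ≤ cos u := by
    have hchord := one_sub_mul_le_cos hu.1 hu.2
    rwa [mul_sub, div_mul_div_cancel₀' two_ne_zero, div_self pi_ne_zero]
  have hcos0 : 0 ≤ 2 / π * (π / 2 - u) := mul_nonneg (by positivity) (sub_nonneg.2 hu.2)
  have hle : k * (sin m * (2 / π * (π / 2 - u))) ≤ k * (sin w * cos u) :=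
    mul_le_mul_of_nonneg_left (mul_le_mul hsin hcos hcos0 (hsin0.trans hsin)) hk
  linarith

end Interval

variable {a : ℝ}

lemma mapsTo_sideMap_Icc (ha0 : 0 ≤ a) (ha : a ≤ 1 / 3) {w₀ : ℝ × ℝ} (hw₀ : 0 ≤ w₀) :
    Set.MapsTo (sideMap a) (Set.Icc w₀ (π / 2, π / 2)) (Set.Icc w₀ (π / 2, π / 2)) := by
  rintro w ⟨hw, hw'⟩
  have h₁ : w.1 ∈ Set.Icc 0 (π / 2) := ⟨(hw₀.trans hw).1, hw'.1⟩
  have h₂ : w.2 ∈ Set.Icc 0 (π / 2) := ⟨(hw₀.trans hw).2, hw'.2⟩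
  exact ⟨⟨hw.1.trans (le_add_mul_sin_mul_cos ha0 h₁ h₂),
      hw.2.trans (le_add_mul_sin_mul_cos (by linarith) h₂ h₁)⟩,
    add_mul_sin_mul_cos_le ha0 (by linarith) h₁,
    add_mul_sin_mul_cos_le (by linarith) (by linarith) h₂⟩

lemma mapsTo_clockMap_preimage_Icc (ha0 : 0 ≤ a) (ha : a ≤ 1 / 3) {w₀ : ℝ × ℝ} (hw₀ : 0 ≤ w₀) :
    Set.MapsTo (clockMap a) (sideCoords ⁻¹' Set.Icc w₀ (π / 2, π / 2))
      (sideCoords ⁻¹' Set.Icc w₀ (π / 2, π / 2)) := fun z hz => by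
  rw [Set.mem_preimage, (semiconj_sideMap a).eq]
  exact mapsTo_sideMap_Icc ha0 ha hw₀ hz

lemma mapsTo_clockMap_smallSquare (ha0 : 0 ≤ a) (ha : a ≤ 1 / 3) :
    Set.MapsTo (clockMap a) smallSquare smallSquare := fun _ hz =>
  mem_smallSquare_iff.2 (mapsTo_clockMap_preimage_Icc ha0 ha le_rfl (mem_smallSquare_iff.1 hz))

lemma mul_sin_mul_two_div_pi_le_one (ha0 : 0 ≤ a) (ha : a ≤ 1) (m : ℝ) :
    a * sin m * (2 / π) ≤ 1 :=
  mul_le_one₀ ((mul_le_of_le_one_right ha0 (sin_le_one m)).trans ha) (by positivity)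
    ((div_le_one pi_pos).2 two_le_pi)

lemma dist_sideMap_le (ha0 : 0 ≤ a) (ha : a ≤ 1 / 3) {m : ℝ} (hm : 0 ≤ m) {w : ℝ × ℝ}
    (hw : w ∈ Set.Icc (m, m) (π / 2, π / 2)) :
    dist (sideMap a w) (π / 2, π / 2)
      ≤ (1 - a * sin m * (2 / π)) * dist w (π / 2, π / 2) := by
  have hdist {z : ℝ × ℝ} (hz : z ≤ (π / 2, π / 2)) :
      dist z (π / 2, π / 2) = max (π / 2 - z.1) (π / 2 - z.2) := by
    rw [Prod.dist_eq, dist_comm, dist_comm z.2, dist_eq, dist_eq,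
      abs_of_nonneg (sub_nonneg.2 hz.1), abs_of_nonneg (sub_nonneg.2 hz.2)]
  have hsin : 0 ≤ sin m :=
    sin_nonneg_of_nonneg_of_le_pi hm (by linarith [hw.1.1.trans hw.2.1, pi_pos])
  have hc : 0 ≤ 1 - a * sin m * (2 / π) :=
    sub_nonneg.2 (mul_sin_mul_two_div_pi_le_one ha0 (by linarith) m)
  have h₁ : w.1 ∈ Set.Icc 0 (π / 2) := ⟨hm.trans hw.1.1, hw.2.1⟩
  have h₂ : w.2 ∈ Set.Icc 0 (π / 2) := ⟨hm.trans hw.1.2, hw.2.2⟩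
  rw [hdist (mapsTo_sideMap_Icc ha0 ha (w₀ := (m, m)) ⟨hm, hm⟩ hw).2, hdist hw.2,
    mul_max_of_nonneg _ _ hc]
  refine max_le_max (pi_div_two_sub_add_mul_sin_mul_cos_le ha0 hm h₁ ⟨hw.1.2, hw.2.2⟩)
    ((pi_div_two_sub_add_mul_sin_mul_cos_le (by positivity) hm h₂ ⟨hw.1.1, hw.2.1⟩).trans ?_)
  refine mul_le_mul_of_nonneg_right ?_ (sub_nonneg.2 h₂.2)
  gcongr
  linarith

lemma tendstoUniformlyOn_iterate_sideMap (ha0 : 0 < a) (ha : a ≤ 1 / 3) {m : ℝ} (hm : 0 < m)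
    (hm' : m ≤ π / 2) :
    TendstoUniformlyOn (fun n => (sideMap a)^[n]) (fun _ => (π / 2, π / 2)) atTop
      (Set.Icc (m, m) (π / 2, π / 2)) := by
  have hsin : 0 < sin m := sin_pos_of_pos_of_lt_pi hm (by linarith [pi_pos])
  exact tendstoUniformlyOn_iterate_of_dist_le
    (mapsTo_sideMap_Icc ha0.le ha (w₀ := (m, m)) ⟨hm.le, hm.le⟩)
    (sub_nonneg.2 (mul_sin_mul_two_div_pi_le_one ha0.le (by linarith) m))
    (sub_lt_self 1 (by positivity)) (fun w hw => dist_sideMap_le ha0.le ha hm.le hw)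
    (fun w hw => Metric.dist_le_diam_of_mem isCompact_Icc.isBounded hw
      (Set.right_mem_Icc.2 ⟨hm', hm'⟩))

lemma tendstoUniformlyOn_iterate_clockMap (ha0 : 0 < a) (ha : a ≤ 1 / 3) {m : ℝ} (hm : 0 < m)
    (hm' : m ≤ π / 2) :
    TendstoUniformlyOn (fun n => (clockMap a)^[n]) (fun _ => (π, π)) atTop
      (sideCoords ⁻¹' Set.Icc (m, m) (π / 2, π / 2)) := by
  have h := uniformContinuous_sideCoords_symm.comp_tendstoUniformlyOn
    ((tendstoUniformlyOn_iterate_sideMap ha0 ha hm hm').comp sideCoords)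
  have hcorner : sideCoords.symm (π / 2, π / 2) = (π, π) := by
    rw [sideCoords_symm_apply]; ext <;> ring
  refine (h.congr (Eventually.of_forall fun n z _ => ?_)).congr_right fun z _ => hcorner
  simp only [Function.comp_apply]
  rw [← ((semiconj_sideMap a).iterate_right n).eq, Equiv.symm_apply_apply]

end Square

section Branch

lemma eventually_mul_lt_of_hasDerivAt {f : ℝ → ℝ} {D k : ℝ} (hf : HasDerivAt f D 0)
    (h0 : f 0 = 0) (hk : k < D) : ∀ᶠ t in 𝓝[>] 0, k * t < f t := by
  filter_upwards [hf.tendsto_slope_zero_right.eventually_const_lt hk, self_mem_nhdsWithin]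
    with t ht ht0
  rwa [zero_add, h0, sub_zero, smul_eq_mul, inv_mul_eq_div, lt_div_iff₀ ht0] at ht

namespace IsUnstableParametrization

variable {a l t : ℝ} {σ : ℝ → ℝ × ℝ}

lemma eventually_sideCoords_mem_Icc {F : ℝ × ℝ → ℝ × ℝ}
    (hσ : IsUnstableParametrization F (π, 0) (2 - √3, 1) l σ) :
    ∀ᶠ t in 𝓝[>] 0, sideCoords (σ t) ∈ Set.Icc (t / 4, t / 4) (π / 2, π / 2) := by
  have hfst : HasDerivAt (fun t => (σ t).1) (2 - √3) 0 := hσ.hasDerivAt_zero.fst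
  have hsnd : HasDerivAt (fun t => (σ t).2) 1 0 := hσ.hasDerivAt_zero.snd
  have hd₁ : HasDerivAt (fun t => (sideCoords (σ t)).1) ((1 - (2 - √3)) / 2) 0 :=
    ((hsnd.sub hfst).add_const π).div_const 2
  have hd₂ : HasDerivAt (fun t => (sideCoords (σ t)).2) ((2 - √3 + 1) / 2) 0 :=
    ((hfst.add hsnd).sub_const π).div_const 2
  have h0 : sideCoords (σ 0) = 0 := by
    rw [hσ.apply_zero, sideCoords_apply]; ext <;> simp
  have hsqrt : √3 < 2 := (sqrt_lt' two_pos).2 (by norm_num)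
  have hsqrt' : 3 / 2 < √3 := lt_sqrt_of_sq_lt (by norm_num)
  have hπ (f : ℝ → ℝ) {D : ℝ} (hf : HasDerivAt f D 0) (hf0 : f 0 = 0) :
      ∀ᶠ t in 𝓝[>] 0, f t < π / 2 :=
    nhdsWithin_le_nhds (hf.continuousAt.eventually_lt_const (by rw [hf0]; positivity))
  filter_upwards [eventually_mul_lt_of_hasDerivAt (k := 1 / 4) hd₁ (by rw [h0]; rfl) (by linarith),
    eventually_mul_lt_of_hasDerivAt (k := 1 / 4) hd₂ (by rw [h0]; rfl) (by linarith),
    hπ _ hd₁ (by rw [h0]; rfl), hπ _ hd₂ (by rw [h0]; rfl)] with t h₁ h₂ h₃ h₄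
  exact ⟨⟨by linarith, by linarith⟩, h₃.le, h₄.le⟩

lemma exists_forall_ge_sideCoords_mem_Icc
    (hσ : IsUnstableParametrization (clockMap a) (π, 0) (2 - √3, 1) l σ) (hl : 1 < l)
    (ha0 : 0 ≤ a) (ha : a ≤ 1 / 3) (ht : 0 < t) :
    ∃ m > 0, ∃ ε ≤ t, ∀ s, ε ≤ s → sideCoords (σ s) ∈ Set.Icc (m, m) (π / 2, π / 2) := by
  obtain ⟨ε₀, hε₀, hmem⟩ := mem_nhdsGT_iff_exists_Ioo_subset.1 hσ.eventually_sideCoords_mem_Icc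
  have hl0 : 0 < l := one_pos.trans hl
  obtain ⟨ε, hε, hε'⟩ := exists_between (lt_min ht (div_pos hε₀ hl0))
  obtain ⟨hεt, hεl⟩ := lt_min_iff.1 hε'
  refine ⟨ε / 4, by positivity, ε, hεt.le, fun s hs => hσ.apply_mem_of_le hl
    (mapsTo_clockMap_preimage_Icc ha0 ha ⟨by positivity, by positivity⟩) hε (fun r hr => ?_) hs⟩
  obtain ⟨hlow, hup⟩ := hmem ⟨hε.trans_le hr.1, hr.2.trans ((lt_div_iff₀' hl0).1 hεl)⟩
  have hεr : ε / 4 ≤ r / 4 := by linarith [hr.1]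
  exact ⟨⟨hεr.trans hlow.1, hεr.trans hlow.2⟩, hup⟩

lemma tendsto_atTop_sink
    (hσ : IsUnstableParametrization (clockMap a) (π, 0) (2 - √3, 1) l σ) (hl : 1 < l)
    (ha0 : 0 < a) (ha : a ≤ 1 / 3) : Tendsto σ atTop (𝓝 (π, π)) := by
  obtain ⟨m, hm, ε, -, hmem⟩ :=
    hσ.exists_forall_ge_sideCoords_mem_Icc hl ha0.le ha one_pos
  have hm' : m ≤ π / 2 := ((hmem ε le_rfl).1.trans (hmem ε le_rfl).2).1
  exact hσ.tendsto_atTop hl (tendstoUniformlyOn_iterate_clockMap ha0 ha hm hm') hmem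

lemma image_Ioi_eq_range_inter_smallSquare
    (hσ : IsUnstableParametrization (clockMap a) (π, 0) (2 - √3, 1) l σ) (hl : 1 < l)
    (hneg : ∀ t, σ (-t) = Equiv.pointReflection (π, 0) (σ t)) (ha0 : 0 ≤ a) (ha : a ≤ 1 / 3) :
    σ '' Set.Ioi 0 = (Set.range σ ∩ smallSquare) \ {(π, 0)} := by
  have hbranch {t : ℝ} (ht : 0 < t) : σ t ∈ smallSquare ∧ 0 < (sideCoords (σ t)).1 := by
    obtain ⟨m, hm, ε, hε, hmem⟩ := hσ.exists_forall_ge_sideCoords_mem_Icc hl ha0 ha ht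
    obtain ⟨hlow, hup⟩ := hmem t hε
    exact ⟨mem_smallSquare_iff.2 ⟨⟨hm.le.trans hlow.1, hm.le.trans hlow.2⟩, hup⟩,
      hm.trans_le hlow.1⟩
  ext z
  constructor
  · rintro ⟨t, ht, rfl⟩
    refine ⟨⟨Set.mem_range_self t, (hbranch ht).1⟩, fun hsaddle => ?_⟩
    have hpos := (hbranch ht).2
    rw [Set.mem_singleton_iff.1 hsaddle, sideCoords_apply] at hpos
    simp at hpos
  · rintro ⟨⟨⟨t, rfl⟩, hsquare⟩, hsaddle⟩
    refine ⟨t, Set.mem_Ioi.2 (lt_of_not_ge fun ht => ?_), rfl⟩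
    rcases ht.lt_or_eq with ht | rfl
    · have hpos := (hbranch (neg_pos.2 ht)).2
      rw [hneg, sideCoords_pointReflection] at hpos
      exact (neg_pos.1 hpos).not_ge (mem_smallSquare_iff.1 hsquare).1.1
    · exact hsaddle hσ.apply_zero

end IsUnstableParametrization

end Branch

end ClockMap

end AlignedClocks

open AlignedClocks Real in
theorem theorem2_general (a : ℝ) (ha0 : 0 < a) (ha : a < 1 / 3) :
    IsSaddle (clockMap a) (π, 0) ∧ IsSink (clockMap a) (π, π) ∧
    Set.MapsTo (clockMap a) smallSquare smallSquare ∧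
    ∃ C : Set (ℝ × ℝ),
      IsHeteroclinicCurve (clockMap a) (π, 0) (π, π) C ∧
      IsUnstableBranch (clockMap a) (π, 0) (2 - √3, 1) C ∧
      C = (unstableSet (clockMap a) (π, 0) ∩ smallSquare) \ {(π, 0)} := by
  have hl := one_lt_unstableEigenvalue ha0
  have hv : ((2 - √3, 1) : ℝ × ℝ) ≠ 0 := fun h => one_ne_zero (congrArg Prod.snd h)
  obtain ⟨K, hK⟩ := antilipschitzWith_clockMap ha0.le ha
  obtain ⟨σ, hσ, hneg⟩ := exists_isUnstableParametrization_clockMap ha0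
  obtain ⟨U, hU, hUF⟩ := exists_preservesStableCones_clockMap ha0 (by linarith)
  have hrange := hσ.range_eq_unstableSet hl saddleCoords_eigenvector_fst_ne_zero hU hUF
  refine ⟨isSaddle_clockMap ha0 (by linarith), isSink_clockMap ha0 (by linarith),
    mapsTo_clockMap_smallSquare ha0.le ha.le, σ '' Set.Ioi 0,
    hσ.isHeteroclinicCurve hl hv hK (hσ.tendsto_atTop_sink hl ha0 ha.le),
    hσ.isUnstableBranch hl hv hK hrange, ?_⟩
  rw [← hrange, hσ.image_Ioi_eq_range_inter_smallSquare hl hneg ha0.le ha.le]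

theorem theorem2 (a : ℝ) (ha0 : 0 < a) (ha : a < 1 / 6) :
    AlignedClocks.IsSaddle (AlignedClocks.clockMap a) (Real.pi, 0) ∧
    AlignedClocks.IsSink (AlignedClocks.clockMap a) (Real.pi, Real.pi) ∧
    Set.MapsTo (AlignedClocks.clockMap a) AlignedClocks.smallSquare AlignedClocks.smallSquare ∧
    ∃ C : Set (ℝ × ℝ),
      AlignedClocks.IsHeteroclinicCurve (AlignedClocks.clockMap a)
        (Real.pi, 0) (Real.pi, Real.pi) C ∧
      AlignedClocks.IsUnstableBranch (AlignedClocks.clockMap a)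
        (Real.pi, 0) (2 - Real.sqrt 3, 1) C ∧
      C = (AlignedClocks.unstableSet (AlignedClocks.clockMap a) (Real.pi, 0) ∩
        AlignedClocks.smallSquare) \ {(Real.pi, 0)} :=
  theorem2_general a ha0 (by linarith)
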